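/- **Theorem (Annulus).** Let $0<\rho<r<1$, $A_\rho=\{\zeta\in\mathbb{C}:\rho<|\zeta|<1\}$ and $\Gamma_s=\{\zeta\in\mathbb{C}:|\zeta|=s\}$. Let $L^2(\Gamma_s)$ be taken with respect to the arc length measure, and let $H^2(A_\rho)$ be the Hardy space of functions $f$ analytic in $A_\rho$ with $\|f\|_{H^2(A_\rho)}:=\sup_{\rho<s<1}\|f\|_{L^2(\Gamma_s)}<\infty$. Fix $z\in A_\rho\setminus\Gamma_r$ and put $$\gamma(z)=\begin{cases}\dfrac{\ln|z|}{\ln r}, & r<|z|<1,\\[2ex] \dfrac{\ln(|z|/\rho)}{\ln(r/\rho)}, & \rho<|z|<r.\end{cases}$$ 1. There is a constant $C>0$, depending only on $\rho,r,z$, such that for every $\epsilon>0$ and every $f\in H^2(A_\rho)$ with $\|f\|_{H^2(A_\rho)}\le 1$ and $\|f\|_{L^2(\Gamma_r)}\le\epsilon$, $$|f(z)|\le C\,\epsilon^{\gamma(z)}.$$ 2. This bound is asymptotically optimal as $\epsilon\to0$, and is attained by $$M(\zeta)=M_\epsilon(\zeta)=\epsilon^{2-\gamma(z)}\sum_{n\in\mathbb{Z}}\frac{(\overline{z}\zeta)^n}{r^{2n}+\epsilon^2(1+\rho^{2n})},$$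 in the following sense. For every $\epsilon>0$ the series converges absolutely on the closure $\overline{A_\rho}$, $M_\epsilon$ is analytic in (a neighbourhood of) $\overline{A_\rho}$, and $M_\epsilon\in H^2(A_\rho)$. There are constants $C,c>0$, depending only on $\rho,r,z$, such that for every $\epsilon>0$ $$\|M_\epsilon\|_{H^2(A_\rho)}\le C,\qquad \|M_\epsilon\|_{L^2(\Gamma_r)}\le C\epsilon,\qquad |M_\epsilon(z)|\le C\epsilon^{\gamma(z)},$$ and $|M_\epsilon(z)|\ge c\,\epsilon^{\gamma(z)}$ for every $0<\epsilon\le 1$. 3. $M_\epsilon$ is bounded on $\overline{A_\rho}$ uniformly in $\epsilon$: there is a constant $C>0$, depending only on $\rho,r,z$, such that $|M_\epsilon(\zeta)|\le C$ for all $\epsilon>0$ and all $\zeta\in\overline{A_\rho}$. -/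

import Mathlib

open MeasureTheory
open scoped ENNReal ComplexConjugate

namespace AnnulusContinuation

/-- The open annulus `A_ρ = {ζ : ρ < |ζ| < 1}`. -/
def annulus (ρ : ℝ) : Set ℂ := {ζ | ρ < ‖ζ‖ ∧ ‖ζ‖ < 1}

/-- The circle `Γ_r = {ζ : |ζ| = r}`. -/
def circ (r : ℝ) : Set ℂ := {ζ | ‖ζ‖ = r}

/-- The arc length measure `|dτ|` of the circle `Γ_r`, as a measure on `ℂ`: the image of
`r dθ` on `(0, 2π]` under `θ ↦ r e^{iθ}`. -/
noncomputable def arcLength (r : ℝ) : Measure ℂ :=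
  Measure.map (circleMap 0 r)
    (ENNReal.ofReal r • (volume.restrict (Set.Ioc 0 (2 * Real.pi))))

/-- The norm of `L²(Γ_r)` with respect to arc length (not normalized). -/
noncomputable def circleL2Norm (r : ℝ) (f : ℂ → ℂ) : ℝ≥0∞ :=
  eLpNorm f 2 (arcLength r)

/-- `‖f‖_{H²(A_ρ)} = sup_{ρ < s < 1} ‖f‖_{L²(Γ_s)}`, with values in `[0, ∞]`. -/
noncomputable def hardyNorm (ρ : ℝ) (f : ℂ → ℂ) : ℝ≥0∞ :=
  ⨆ s ∈ Set.Ioo ρ 1, circleL2Norm s f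

/-- The Hardy space `H²(A_ρ)`. Its members are represented by functions on `ℂ`, of which only
the restriction to `A_ρ` matters. -/
def hardySpace (ρ : ℝ) : Set (ℂ → ℂ) :=
  {f | AnalyticOnNhd ℂ f (annulus ρ) ∧ hardyNorm ρ f < ∞}

/-- The exponent `γ(z)`, meant for `ρ < |z| < 1`, `|z| ≠ r`. -/
noncomputable def gammaExp (ρ r : ℝ) (z : ℂ) : ℝ :=
  if r < ‖z‖ then Real.log ‖z‖ / Real.log r
  else Real.log (‖z‖ / ρ) / Real.log (r / ρ)

/-- The `n`-th term of the Laurent series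
`∑_{n ∈ ℤ} (z̄ ζ)^n / (r^{2n} + ε² (1 + ρ^{2n}))`. -/
noncomputable def maxTerm (ρ r ε : ℝ) (z ζ : ℂ) (n : ℤ) : ℂ :=
  (conj z * ζ) ^ n / ((r ^ (2 * n) + ε ^ 2 * (1 + ρ ^ (2 * n)) : ℝ) : ℂ)

/-- `M(ζ) = ε^{2 - γ(z)} ∑_{n ∈ ℤ} (z̄ ζ)^n / (r^{2n} + ε² (1 + ρ^{2n}))`. -/
noncomputable def maxFun (ρ r ε : ℝ) (z ζ : ℂ) : ℂ :=
  ((ε ^ (2 - gammaExp ρ r z) : ℝ) : ℂ) * ∑' n : ℤ, maxTerm ρ r ε z ζ n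

end AnnulusContinuation

open AnnulusContinuation

namespace AnnulusContinuation

/-! Everything reduces to one estimate, `tsum_kernel_le`: for `0 < α < β` the sum of `q^(αn) /
(q^(βn) + ε^β)` over `n ∈ ℤ` is `O(ε^(α-β))`, since it decays geometrically on both sides of the
index where `q^n ≈ ε`. By `gammaExp_spec`, `γ` turns powers of `|z|` into such kernels, with `q = r`
for `n ≥ 0` and `q = ρ/r` for `n < 0`.

Upper bound: the Laurent coefficients of `f` are `O(min(1, ε r^(-n)))` for `n ≥ 0` and `O(min(ρ^j, ε
r^j))` for `n = -j`. Hence the Laurent terms at `z` are at most a constant times `ε` times kernels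
with `α = γ`, `β = 1`, and their sum is `O(ε^γ)`.

Optimality: where `|ζ| ≤ r^δ` and `ρ/|ζ| ≤ (ρ/r)^δ`, the series of `M` is dominated by kernels with
`α = γ + δ`, `β = 2`, so `M = O(ε^δ)` there. At `z` all terms are positive, and a single one already
has the full order. -/

/-! ### Two-sided kernel sums -/

theorem summable_pow_natAbs {κ : ℝ} (h0 : 0 ≤ κ) (h1 : κ < 1) :
    Summable (fun n : ℤ => κ ^ n.natAbs) := by
  apply Summable.of_nat_of_neg <;> simpa using summable_geometric_of_lt_one h0 h1

/-- The kernel `(qⁿ)^α / ((qⁿ)^β + ε^β)` is controlled by a two-sided geometric sequence. -/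
theorem kernel_le_geometric {q α β : ℝ} (hq : 0 < q) (hq1 : q < 1) (hα : 0 < α) (hαβ : α < β)
    {ε : ℝ} (hε : 0 < ε) : ∃ m : ℤ, ∀ n : ℤ,
      (q ^ (n + m)) ^ α / ((q ^ (n + m)) ^ β + ε ^ β) ≤
        q ^ (-α) * ε ^ (α - β) * (max (q ^ α) (q ^ (β - α))) ^ n.natAbs := by
  -- The shift `m = -(k + 1)` recentres the sum: `ε < q^m ≤ ε/q`. The term `ε^β` of the denominator
  -- is kept for `n ≥ 0`, the other term for `n ≤ 0`.
  obtain ⟨k, hk1, hk2⟩ := exists_mem_Ico_zpow hε ((one_lt_inv₀ hq).2 hq1)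
  have e1 : q ^ (-k) ≤ ε := by simpa using hk1
  have e2 : ε < q ^ (-(k + 1)) := by simpa only [inv_zpow', neg_add] using hk2
  set m : ℤ := -(k + 1) with hm
  have e1' : q ^ m ≤ ε / q := by
    rw [le_div_iff₀ hq, ← zpow_add_one₀ hq.ne']
    simpa [hm] using e1
  have hqa : q ^ (-α) * q ^ α = 1 := by rw [← Real.rpow_add hq]; simp
  refine ⟨m, fun n => ?_⟩
  have hx : 0 < q ^ (n + m) := zpow_pos hq _
  have hxβ : 0 < (q ^ (n + m)) ^ β := Real.rpow_pos_of_pos hx _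
  have hεβ : 0 < ε ^ β := Real.rpow_pos_of_pos hε _
  have hone : 1 ≤ q ^ (-α) := Real.one_le_rpow_of_pos_of_le_one_of_nonpos hq hq1.le (by linarith)
  have hmm : 0 < q ^ m := zpow_pos hq _
  obtain ⟨j, rfl | rfl⟩ := n.eq_nat_or_neg
  · calc _ ≤ (q ^ ((j : ℤ) + m)) ^ α / ε ^ β := by gcongr; linarith
      _ = (q ^ α) ^ j * (q ^ m) ^ α / ε ^ β := by
          rw [zpow_add₀ hq.ne', Real.mul_rpow (zpow_pos hq _).le hmm.le, zpow_natCast,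
            ← Real.rpow_natCast, ← Real.rpow_natCast, ← Real.rpow_mul hq.le,
            ← Real.rpow_mul hq.le, mul_comm (j : ℝ)]
      _ ≤ (q ^ α) ^ j * (ε / q) ^ α / ε ^ β := by gcongr
      _ = q ^ (-α) * ε ^ (α - β) * (q ^ α) ^ j := by
          rw [Real.div_rpow hε.le hq.le, Real.rpow_neg hq.le, Real.rpow_sub hε]
          field_simp
      _ ≤ _ := by
          simp only [Int.natAbs_natCast]
          gcongr
          exact le_max_left _ _
  · calc _ ≤ (q ^ (-(j : ℤ) + m)) ^ α / (q ^ (-(j : ℤ) + m)) ^ β := by gcongr; linarith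
      _ = (q ^ (-(j : ℤ) + m)) ^ (α - β) := by rw [Real.rpow_sub hx]
      _ = (q ^ (β - α)) ^ j * (q ^ m) ^ (α - β) := by
          rw [zpow_add₀ hq.ne', Real.mul_rpow (zpow_pos hq _).le hmm.le]
          congr 1
          rw [← Real.rpow_intCast, ← Real.rpow_natCast, ← Real.rpow_mul hq.le,
            ← Real.rpow_mul hq.le]
          congr 1
          push_cast
          ring
      _ ≤ (q ^ (β - α)) ^ j * ε ^ (α - β) := by
          have := Real.rpow_le_rpow_of_nonpos hε e2.le (by linarith : α - β ≤ 0)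
          gcongr
      _ = 1 * ε ^ (α - β) * (q ^ (β - α)) ^ j := by ring
      _ ≤ _ := by
          simp only [Int.natAbs_neg, Int.natAbs_natCast]
          gcongr
          exact le_max_right _ _

/-- The two-sided sum of the kernel is of order `ε^(α-β)`, uniformly in `ε`. -/
theorem tsum_kernel_le {q α β : ℝ} (hq : 0 < q) (hq1 : q < 1) (hα : 0 < α) (hαβ : α < β) :
    ∃ C : ℝ, 0 < C ∧ ∀ ε : ℝ, 0 < ε →
      Summable (fun n : ℤ => (q ^ n) ^ α / ((q ^ n) ^ β + ε ^ β)) ∧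
      ∑' n : ℤ, (q ^ n) ^ α / ((q ^ n) ^ β + ε ^ β) ≤ C * ε ^ (α - β) := by
  set κ := max (q ^ α) (q ^ (β - α)) with hκ
  have hκ0 : 0 < κ := lt_max_of_lt_left (Real.rpow_pos_of_pos hq _)
  have hκ1 : κ < 1 := max_lt (Real.rpow_lt_one hq.le hq1 hα) (Real.rpow_lt_one hq.le hq1 (by linarith))
  have hs := summable_pow_natAbs hκ0.le hκ1
  refine ⟨q ^ (-α) * ∑' n : ℤ, κ ^ n.natAbs,
    mul_pos (Real.rpow_pos_of_pos hq _) (hs.tsum_pos (fun n => by positivity) 0 (by simp)),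
    fun ε hε => ?_⟩
  obtain ⟨m, hm⟩ := kernel_le_geometric hq hq1 hα hαβ hε
  have hs' := hs.mul_left (q ^ (-α) * ε ^ (α - β))
  have hsum : Summable (fun n : ℤ => (q ^ (n + m)) ^ α / ((q ^ (n + m)) ^ β + ε ^ β)) :=
    hs'.of_nonneg_of_le (fun n => by positivity) hm
  constructor
  · exact (Equiv.addRight m).summable_iff.1 hsum
  · rw [← (Equiv.addRight m).tsum_eq]
    refine (hsum.tsum_le_tsum hm hs').trans_eq ?_
    rw [tsum_mul_left]
    ring

/-- A nonnegative two-sided sequence dominated by one kernel on each side has a sum of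
order `ε^(α-β)`. -/
theorem tsum_le_of_le_kernels {p q α β : ℝ} (hp : 0 < p) (hp1 : p < 1) (hq : 0 < q) (hq1 : q < 1)
    (hα : 0 < α) (hαβ : α < β) :
    ∃ C : ℝ, 0 < C ∧ ∀ ε : ℝ, 0 < ε → ∀ v : ℤ → ℝ, (∀ n, 0 ≤ v n) →
      (∀ n : ℕ, v n ≤ (p ^ n) ^ α / ((p ^ n) ^ β + ε ^ β)) →
      (∀ n : ℕ, v (-n) ≤ (q ^ n) ^ α / ((q ^ n) ^ β + ε ^ β)) →
      Summable v ∧ ∑' n, v n ≤ C * ε ^ (α - β) := by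
  obtain ⟨C₁, hC₁, h₁⟩ := tsum_kernel_le hp hp1 hα hαβ
  obtain ⟨C₂, hC₂, h₂⟩ := tsum_kernel_le hq hq1 hα hαβ
  refine ⟨C₁ + C₂, by positivity, fun ε hε v hv hvp hvq => ?_⟩
  obtain ⟨s₁, t₁⟩ := h₁ ε hε
  obtain ⟨s₂, t₂⟩ := h₂ ε hε
  have s₂' := (Equiv.neg ℤ).summable_iff.2 s₂
  have hle : ∀ n : ℤ, v n ≤ (p ^ n) ^ α / ((p ^ n) ^ β + ε ^ β) +
      ((fun n : ℤ => (q ^ n) ^ α / ((q ^ n) ^ β + ε ^ β)) ∘ Equiv.neg ℤ) n := by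
    intro n
    have hP : 0 ≤ (p ^ n) ^ α / ((p ^ n) ^ β + ε ^ β) := by positivity
    have hQ : 0 ≤ ((fun n : ℤ => (q ^ n) ^ α / ((q ^ n) ^ β + ε ^ β)) ∘ Equiv.neg ℤ) n := by
      simp only [Function.comp]; positivity
    obtain ⟨j, rfl | rfl⟩ := n.eq_nat_or_neg
    · have := hvp j
      simp only [zpow_natCast] at hP ⊢
      linarith
    · have := hvq j
      simp only [Function.comp, Equiv.neg_apply, neg_neg, zpow_natCast] at hQ ⊢
      linarith
  have hs := (s₁.add s₂').of_nonneg_of_le hv hle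
  refine ⟨hs, (hs.tsum_le_tsum hle (s₁.add s₂')).trans ?_⟩
  rw [s₁.tsum_add s₂']
  have := (Equiv.neg ℤ).tsum_eq (fun n : ℤ => (q ^ n) ^ α / ((q ^ n) ^ β + ε ^ β))
  simp only [Function.comp] at *
  rw [this]
  linarith

/-! ### The exponent -/

/-- The properties of the exponent `γ(z)` on which all estimates rest. -/
theorem gammaExp_spec {ρ r : ℝ} (hρ : 0 < ρ) (hρr : ρ < r) (hr : r < 1) {z : ℂ}
    (hz : z ∈ annulus ρ \ circ r) :
    0 < gammaExp ρ r z ∧ gammaExp ρ r z < 1 ∧ ‖z‖ ≤ r ^ gammaExp ρ r z ∧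
      ρ / ‖z‖ ≤ (ρ / r) ^ gammaExp ρ r z ∧
      (‖z‖ = r ^ gammaExp ρ r z ∨ ρ / ‖z‖ = (ρ / r) ^ gammaExp ρ r z) := by
  obtain ⟨⟨h1, h2⟩, h3⟩ := hz
  change ¬ (‖z‖ = r) at h3
  have hr0 : 0 < r := hρ.trans hρr
  have ha0 : 0 < ‖z‖ := hρ.trans h1
  have hq : 0 < ρ / r := by positivity
  have lr : Real.log r < 0 := Real.log_neg hr0 hr
  have la : Real.log ‖z‖ < 0 := Real.log_neg ha0 h2
  have lρr := Real.log_lt_log hρ hρr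
  have lρa := Real.log_lt_log hρ h1
  have key : ∀ g : ℝ, (‖z‖ ≤ r ^ g ↔ Real.log ‖z‖ ≤ g * Real.log r) ∧
      (ρ / ‖z‖ ≤ (ρ / r) ^ g ↔ Real.log ρ - Real.log ‖z‖ ≤ g * (Real.log ρ - Real.log r)) := by
    intro g
    constructor
    · rw [← Real.log_rpow hr0, Real.log_le_log_iff ha0 (Real.rpow_pos_of_pos hr0 _)]
    · rw [← Real.log_div hρ.ne' ha0.ne', ← Real.log_div hρ.ne' hr0.ne', ← Real.log_rpow hq,
        Real.log_le_log_iff (by positivity) (Real.rpow_pos_of_pos hq _)]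
  have keyeq : ∀ g : ℝ, (Real.log ‖z‖ = g * Real.log r → ‖z‖ = r ^ g) ∧
      (Real.log ρ - Real.log ‖z‖ = g * (Real.log ρ - Real.log r) →
        ρ / ‖z‖ = (ρ / r) ^ g) := by
    intro g
    constructor <;> intro h
    · exact Real.log_injOn_pos ha0 (Real.rpow_pos_of_pos hr0 _) (by rw [Real.log_rpow hr0, h])
    · exact Real.log_injOn_pos (show 0 < ρ / ‖z‖ by positivity) (Real.rpow_pos_of_pos hq _)
        (by rw [Real.log_rpow hq, Real.log_div hρ.ne' ha0.ne', Real.log_div hρ.ne' hr0.ne', h])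
  rw [(key _).1, (key _).2]
  unfold gammaExp
  split_ifs with hlt
  -- Here `|z| = r^γ`, and the other inequality amounts to `ρ ≤ ρ^γ`.
  · have lra := Real.log_lt_log hr0 hlt
    have e : Real.log ‖z‖ / Real.log r * Real.log r = Real.log ‖z‖ := div_mul_cancel₀ _ lr.ne
    have g1 : Real.log ‖z‖ / Real.log r < 1 := by rw [div_lt_one_of_neg lr]; exact lra
    exact ⟨div_pos_of_neg_of_neg la lr, g1, e.ge, by nlinarith, Or.inl ((keyeq _).1 e.symm)⟩
  -- Here `|z| = ρ^(1-γ) r^γ`, which is at most `r^γ`.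
  · have lar := Real.log_lt_log ha0 (lt_of_le_of_ne (not_lt.1 hlt) h3)
    rw [Real.log_div ha0.ne' hρ.ne', Real.log_div hr0.ne' hρ.ne']
    have hpos : 0 < Real.log r - Real.log ρ := by linarith
    have e := div_mul_cancel₀ (Real.log ‖z‖ - Real.log ρ) hpos.ne'
    have g1 : (Real.log ‖z‖ - Real.log ρ) / (Real.log r - Real.log ρ) < 1 := by
      rw [div_lt_one hpos]; linarith
    have g0 : 0 < (Real.log ‖z‖ - Real.log ρ) / (Real.log r - Real.log ρ) :=
      div_pos (by linarith) hpos
    exact ⟨g0, g1, by nlinarith, by linarith, Or.inr ((keyeq _).2 (by linarith))⟩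

/-! ### Size and analyticity of `M` -/

theorem maxTerm_denom_pos {ρ r : ℝ} (hρ : 0 < ρ) (hr : 0 < r) (ε : ℝ) (n : ℤ) :
    0 < r ^ (2 * n) + ε ^ 2 * (1 + ρ ^ (2 * n)) := by
  have := zpow_pos hr (2 * n)
  have := zpow_pos hρ (2 * n)
  positivity

theorem norm_maxTerm {ρ r : ℝ} (hρ : 0 < ρ) (hr : 0 < r) (ε : ℝ) (z ζ : ℂ) (n : ℤ) :
    ‖maxTerm ρ r ε z ζ n‖ =
      (‖z‖ * ‖ζ‖) ^ n / (r ^ (2 * n) + ε ^ 2 * (1 + ρ ^ (2 * n))) := by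
  rw [maxTerm, norm_div, norm_zpow, norm_mul, RCLike.norm_conj, Complex.norm_real,
    Real.norm_of_nonneg (maxTerm_denom_pos hρ hr ε n).le]

theorem norm_maxTerm_natCast_le {ρ r : ℝ} (hρ : 0 < ρ) (hr : 0 < r) (ε : ℝ) (z ζ : ℂ) (n : ℕ) :
    ‖maxTerm ρ r ε z ζ n‖ ≤ (‖z‖ * ‖ζ‖) ^ n / ((r ^ n) ^ 2 + ε ^ 2) := by
  rw [norm_maxTerm hρ hr, zpow_natCast]
  have h1 : r ^ (2 * (n : ℤ)) = (r ^ n) ^ 2 := by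
    rw [← pow_mul, mul_comm n]; exact_mod_cast zpow_natCast r (2 * n)
  have h2 : 0 < ρ ^ (2 * (n : ℤ)) := zpow_pos hρ _
  rw [h1]
  gcongr
  nlinarith [sq_nonneg ε]

/-- For negative indices `ρ^(2n)` is the part of `1 + ρ^(2n)` to keep; clearing it gives the same
shape as for `n ≥ 0`, with `r` replaced by `ρ/r`. -/
theorem norm_maxTerm_neg_natCast_le {ρ r : ℝ} (hρ : 0 < ρ) (hr : 0 < r) {ε : ℝ} (hε : 0 < ε)
    (z ζ : ℂ) (n : ℕ) :
    ‖maxTerm ρ r ε z ζ (-n)‖ ≤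
      ((ρ / ‖z‖) * (ρ / ‖ζ‖)) ^ n / (((ρ / r) ^ n) ^ 2 + ε ^ 2) := by
  rw [norm_maxTerm hρ hr, zpow_neg, zpow_natCast]
  have h1 : ∀ x : ℝ, x ^ (2 * -(n : ℤ)) = ((x ^ n) ^ 2)⁻¹ := by
    intro x
    rw [← pow_mul, mul_comm n, mul_neg, zpow_neg]; exact_mod_cast congrArg _ (zpow_natCast x (2 * n))
  rw [h1, h1]
  calc _ ≤ ((‖z‖ * ‖ζ‖) ^ n)⁻¹ / (((r ^ n) ^ 2)⁻¹ + ε ^ 2 * ((ρ ^ n) ^ 2)⁻¹) := by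
        gcongr
        linarith
    _ = _ := by
        rw [div_mul_div_comm, div_pow, div_pow]
        field_simp
        rw [← pow_mul, ← pow_mul, mul_comm]

/-- On the circle of radius `x`, where `x ≤ r^δ` and `ρ/x ≤ (ρ/r)^δ`, the terms of the series
have a sum of order `ε^(γ+δ-2)`. -/
theorem tsum_norm_maxTerm_le {ρ r : ℝ} (hρ : 0 < ρ) (hρr : ρ < r) (hr : r < 1) {z : ℂ}
    (hz : z ≠ 0) {g δ : ℝ} (hg : 0 < g + δ) (hg2 : g + δ < 2)
    (h1 : ‖z‖ ≤ r ^ g) (h2 : ρ / ‖z‖ ≤ (ρ / r) ^ g) :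
    ∃ C : ℝ, 0 < C ∧ ∀ ε : ℝ, 0 < ε → ∀ ζ : ℂ, ‖ζ‖ ≤ r ^ δ → ρ / ‖ζ‖ ≤ (ρ / r) ^ δ →
      Summable (fun n => ‖maxTerm ρ r ε z ζ n‖) ∧
      ∑' n, ‖maxTerm ρ r ε z ζ n‖ ≤ C * ε ^ (g + δ - 2) := by
  have hr0 : 0 < r := hρ.trans hρr
  have hq : 0 < ρ / r := by positivity
  obtain ⟨C, hC, h⟩ := tsum_le_of_le_kernels hr0 hr hq ((div_lt_one hr0).2 hρr) hg hg2
  refine ⟨C, hC, fun ε hε ζ k1 k2 => h ε hε _ (fun n => norm_nonneg _) (fun n => ?_) (fun n => ?_)⟩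
  · refine (norm_maxTerm_natCast_le hρ hr0 ε z ζ n).trans ?_
    rw [Real.rpow_two, Real.rpow_two, ← Real.rpow_pow_comm hr0.le, Real.rpow_add hr0]
    gcongr
  · refine (norm_maxTerm_neg_natCast_le hρ hr0 hε z ζ n).trans ?_
    rw [Real.rpow_two, Real.rpow_two, ← Real.rpow_pow_comm hq.le, Real.rpow_add hq]
    gcongr

/-- The prefactor `ε^(2-γ)` cancels all of `ε^(γ+δ-2)` except `ε^δ`. The uses are `δ = 0` (closed
annulus), `δ = 1` (the circle of radius `r`) and `δ = γ` (the point `z`). -/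
theorem norm_maxFun_le {ρ r : ℝ} (hρ : 0 < ρ) (hρr : ρ < r) (hr : r < 1) {z : ℂ}
    (hz : z ∈ annulus ρ \ circ r) {δ : ℝ} (hδ : 0 ≤ δ) (hδ1 : δ ≤ 1) :
    ∃ C : ℝ, 0 < C ∧ ∀ ε : ℝ, 0 < ε → ∀ ζ : ℂ, ‖ζ‖ ≤ r ^ δ → ρ / ‖ζ‖ ≤ (ρ / r) ^ δ →
      Summable (maxTerm ρ r ε z ζ) ∧ ‖maxFun ρ r ε z ζ‖ ≤ C * ε ^ δ := by
  obtain ⟨g0, g1, h1, h2, -⟩ := gammaExp_spec hρ hρr hr hz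
  have hz0 : z ≠ 0 := norm_pos_iff.1 (hρ.trans hz.1.1)
  obtain ⟨C, hC, h⟩ := tsum_norm_maxTerm_le hρ hρr hr hz0 (δ := δ) (by linarith) (by linarith) h1 h2
  refine ⟨C, hC, fun ε hε ζ k1 k2 => ?_⟩
  obtain ⟨hs, ht⟩ := h ε hε ζ k1 k2
  refine ⟨hs.of_norm, ?_⟩
  have hp := Real.rpow_pos_of_pos hε (2 - gammaExp ρ r z)
  calc ‖maxFun ρ r ε z ζ‖ = ε ^ (2 - gammaExp ρ r z) * ‖∑' n, maxTerm ρ r ε z ζ n‖ := by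
        rw [maxFun, norm_mul, Complex.norm_real, Real.norm_of_nonneg hp.le]
    _ ≤ ε ^ (2 - gammaExp ρ r z) * (C * ε ^ (gammaExp ρ r z + δ - 2)) := by
        gcongr
        exact (norm_tsum_le_tsum_norm hs).trans ht
    _ = C * ε ^ δ := by
        rw [mul_left_comm, ← Real.rpow_add hε]
        congr 2
        ring

theorem closure_annulus_subset (ρ : ℝ) : closure (annulus ρ) ⊆ {ζ | ρ ≤ ‖ζ‖ ∧ ‖ζ‖ ≤ 1} :=
  closure_minimal (fun _ h => ⟨h.1.le, h.2.le⟩)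
    ((isClosed_le continuous_const continuous_norm).inter
      (isClosed_le continuous_norm continuous_const))

/-- For fixed `ε`, bounding the denominators below by `ε^2` alone leaves a geometric majorant on a
slightly larger open annulus. -/
theorem analyticOnNhd_maxFun {ρ r : ℝ} (hρ : 0 < ρ) (hr : 0 < r) {z : ℂ} (hz : z ∈ annulus ρ)
    {ε : ℝ} (hε : 0 < ε) : AnalyticOnNhd ℂ (maxFun ρ r ε z) {ζ | ρ ≤ ‖ζ‖ ∧ ‖ζ‖ ≤ 1} := by
  obtain ⟨hz1, hz2⟩ := hz
  have ha : 0 < ‖z‖ := hρ.trans hz1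
  -- The radii `σ < ρ` and `R > 1` are chosen so that `|z| R < 1` and `ρ^2 / (|z| σ) < 1`.
  obtain ⟨R, hR1, hR⟩ := exists_between ((one_lt_inv₀ ha).2 hz2)
  obtain ⟨σ, hσ1, hσ⟩ := exists_between (show ρ * (ρ / ‖z‖) < ρ from
    mul_lt_of_lt_one_right hρ ((div_lt_one ha).2 hz1))
  have hσ0 : 0 < σ := lt_trans (by positivity) hσ1
  set κ := max (‖z‖ * R) (ρ / ‖z‖ * (ρ / σ))
  have hκ0 : 0 < κ := lt_max_of_lt_left (mul_pos ha (by linarith))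
  have hκ1 : κ < 1 := by
    refine max_lt ?_ ?_
    · rwa [mul_comm, ← lt_inv_mul_iff₀' ha, mul_one] at *
    · rw [mul_div_assoc', div_lt_one hσ0]; linarith
  have hU : IsOpen {ζ : ℂ | σ < ‖ζ‖ ∧ ‖ζ‖ < R} :=
    (isOpen_lt continuous_const continuous_norm).inter (isOpen_lt continuous_norm continuous_const)
  have hd : DifferentiableOn ℂ (fun ζ => ∑' n : ℤ, maxTerm ρ r ε z ζ n)
      {ζ : ℂ | σ < ‖ζ‖ ∧ ‖ζ‖ < R} := by
    refine Complex.differentiableOn_tsum_of_summable_norm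
      ((summable_pow_natAbs hκ0.le hκ1).div_const (ε ^ 2)) (fun n ζ hζ => ?_) hU
      (fun n ζ hζ => ?_)
    · have : conj z * ζ ≠ 0 := mul_ne_zero
        ((map_ne_zero _).2 (norm_pos_iff.1 ha)) (norm_pos_iff.1 (hσ0.trans hζ.1))
      unfold maxTerm
      refine DifferentiableAt.differentiableWithinAt ?_
      exact ((differentiableAt_id.const_mul (conj z)).zpow (Or.inl this)).div_const _
    · have hζ0 : 0 < ‖ζ‖ := hσ0.trans hζ.1
      obtain ⟨j, rfl | rfl⟩ := n.eq_nat_or_neg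
      · refine (norm_maxTerm_natCast_le hρ hr ε z ζ j).trans ?_
        rw [Int.natAbs_natCast]
        gcongr
        · exact (mul_le_mul_of_nonneg_left hζ.2.le ha.le).trans (le_max_left _ _)
        · nlinarith [sq_nonneg (r ^ j)]
      · refine (norm_maxTerm_neg_natCast_le hρ hr hε z ζ j).trans ?_
        rw [Int.natAbs_neg, Int.natAbs_natCast]
        gcongr
        · refine le_trans ?_ (le_max_right _ _)
          have := hζ.1.le
          gcongr
        · nlinarith [sq_nonneg ((ρ / r) ^ j)]
  intro ζ hζ
  exact (hd.const_mul _).analyticAt (hU.mem_nhds ⟨hσ.trans_le hζ.1, hζ.2.trans_lt hR1⟩)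

/-! ### Lower bound at `z` -/

/-- `M_ε(z)` is at least any one of the terms of its series, all of which are positive. -/
theorem le_norm_maxFun_self {ρ r : ℝ} (hρ : 0 < ρ) (hr : 0 < r) {z : ℂ} {ε : ℝ} (hε : 0 < ε)
    (hs : Summable (maxTerm ρ r ε z z)) (n : ℤ) :
    ε ^ (2 - gammaExp ρ r z) * ‖maxTerm ρ r ε z z n‖ ≤ ‖maxFun ρ r ε z z‖ := by
  have hp := Real.rpow_pos_of_pos hε (2 - gammaExp ρ r z)
  have h : ∀ n, maxTerm ρ r ε z z n = (‖maxTerm ρ r ε z z n‖ : ℝ) := by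
    intro n
    rw [norm_maxTerm hρ hr, maxTerm, Complex.conj_mul']
    push_cast
    rw [sq]
  rw [maxFun, norm_mul, Complex.norm_real, Real.norm_of_nonneg hp.le]
  gcongr
  rw [tsum_congr h, ← Complex.ofReal_tsum, Complex.norm_real]
  exact (hs.norm.le_tsum n fun _ _ => norm_nonneg _).trans (le_abs_self _)

/-- Use the side (`q = r` or `q = ρ/r`) on which `γ` gives equality, and the index with `q^n ≈ ε`;
`ε ≤ 1` ensures `n ≥ 0`. The factor `2` comes from `1 + ρ^(2n) ≤ 2 max(1, ρ^(2n))`. -/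
theorem exists_le_norm_maxTerm {ρ r : ℝ} (hρ : 0 < ρ) (hρr : ρ < r) (hr : r < 1) {z : ℂ}
    (hz : z ≠ 0) {g : ℝ} (hg : 0 < g) (h : ‖z‖ = r ^ g ∨ ρ / ‖z‖ = (ρ / r) ^ g) :
    ∃ c : ℝ, 0 < c ∧ ∀ ε : ℝ, 0 < ε → ε ≤ 1 → ∃ n : ℤ,
      c * ε ^ (2 * g - 2) ≤ ‖maxTerm ρ r ε z z n‖ := by
  have hr0 : 0 < r := hρ.trans hρr
  have ha : 0 < ‖z‖ := norm_pos_iff.2 hz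
  suffices H : ∃ q : ℝ, 0 < q ∧ q < 1 ∧ ∃ s : ℤ, ∀ ε > 0, ∀ n : ℕ,
      (q ^ n) ^ (2 * g) / ((q ^ n) ^ 2 + 2 * ε ^ 2) ≤ ‖maxTerm ρ r ε z z (s * n)‖ by
    obtain ⟨q, hq, hq1, s, H⟩ := H
    refine ⟨(q⁻¹ ^ 2 + 2)⁻¹, by positivity, fun ε hε hε1 => ?_⟩
    obtain ⟨n, hn1, hn2⟩ := exists_nat_pow_near_of_lt_one hε hε1 hq hq1
    refine ⟨s * n, le_trans ?_ (H ε hε n)⟩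
    have hn3 : q ^ n ≤ q⁻¹ * ε := by
      rw [le_inv_mul_iff₀ hq, ← pow_succ']; exact hn1.le
    calc (q⁻¹ ^ 2 + 2)⁻¹ * ε ^ (2 * g - 2)
        = ε ^ (2 * g) / ((q⁻¹ * ε) ^ 2 + 2 * ε ^ 2) := by
          rw [Real.rpow_sub hε, Real.rpow_two]
          field_simp
      _ ≤ _ := by gcongr
  have h2 : ∀ (x : ℝ) (n : ℕ), x ^ (2 * (n : ℤ)) = (x ^ n) ^ 2 := by
    intro x n
    rw [← pow_mul, mul_comm n]; exact_mod_cast zpow_natCast x (2 * n)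
  rcases h with h | h
  · refine ⟨r, hr0, hr, 1, fun ε hε n => ?_⟩
    rw [one_mul, norm_maxTerm hρ hr0, h2, h2, zpow_natCast, ← Real.rpow_pow_comm hr0.le, two_mul,
      Real.rpow_add hr0, ← h]
    have := pow_le_one₀ (n := n) hρ.le (hρr.trans hr).le
    have : (ρ ^ n) ^ 2 ≤ 1 := pow_le_one₀ (by positivity) this
    rw [mul_comm 2 (ε ^ 2)]
    gcongr
    linarith
  · have hq : 0 < ρ / r := by positivity
    refine ⟨ρ / r, hq, (div_lt_one hr0).2 hρr, -1, fun ε hε n => ?_⟩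
    rw [neg_one_mul, norm_maxTerm hρ hr0, mul_neg, zpow_neg, zpow_neg, zpow_neg, h2, h2,
      zpow_natCast, ← Real.rpow_pow_comm hq.le, two_mul, Real.rpow_add hq, ← h]
    have := pow_le_one₀ (n := n) hρ.le (hρr.trans hr).le
    have h1 : (ρ ^ n) ^ 2 ≤ 1 := pow_le_one₀ (by positivity) this
    have h1' : 1 ≤ ((ρ ^ n) ^ 2)⁻¹ := (one_le_inv₀ (by positivity)).2 h1
    calc _ = ((‖z‖ * ‖z‖) ^ n)⁻¹ / (((r ^ n) ^ 2)⁻¹ + 2 * ε ^ 2 * ((ρ ^ n) ^ 2)⁻¹) := by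
          rw [div_mul_div_comm, div_pow, div_pow]
          field_simp
          rw [← pow_mul, ← pow_mul, mul_comm]
      _ ≤ _ := by
          rw [mul_comm 2 (ε ^ 2), mul_assoc]
          gcongr ?_ / (_ + _ * ?_)
          · exact le_rfl
          · linarith

theorem le_norm_maxFun {ρ r : ℝ} (hρ : 0 < ρ) (hρr : ρ < r) (hr : r < 1) {z : ℂ}
    (hz : z ∈ annulus ρ \ circ r) :
    ∃ c : ℝ, 0 < c ∧ ∀ ε : ℝ, 0 < ε → ε ≤ 1 →
      c * ε ^ gammaExp ρ r z ≤ ‖maxFun ρ r ε z z‖ := by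
  obtain ⟨g0, g1, h1, h2, h3⟩ := gammaExp_spec hρ hρr hr hz
  have hz0 : z ≠ 0 := norm_pos_iff.1 (hρ.trans hz.1.1)
  obtain ⟨c, hc, h⟩ := exists_le_norm_maxTerm hρ hρr hr hz0 g0 h3
  obtain ⟨C, -, hS⟩ := norm_maxFun_le hρ hρr hr hz g0.le g1.le
  refine ⟨c, hc, fun ε hε hε1 => ?_⟩
  obtain ⟨n, hn⟩ := h ε hε hε1
  refine le_trans ?_ (le_norm_maxFun_self hρ (hρ.trans hρr) hε (hS ε hε z h1 h2).1 n)
  calc _ = ε ^ (2 - gammaExp ρ r z) * (c * ε ^ (2 * gammaExp ρ r z - 2)) := by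
        rw [mul_left_comm, ← Real.rpow_add hε]
        congr 2
        ring
    _ ≤ _ := by gcongr

/-! ### Norms on circles -/

theorem ae_arcLength_mem_sphere {s : ℝ} (hs : 0 ≤ s) :
    ∀ᵐ ζ ∂(arcLength s), ζ ∈ Metric.sphere (0 : ℂ) s := by
  refine (ae_map_iff (continuous_circleMap 0 s).measurable.aemeasurable
    Metric.isClosed_sphere.measurableSet).2 ?_
  exact Filter.Eventually.of_forall fun θ => circleMap_mem_sphere 0 hs θ

theorem arcLength_univ (s : ℝ) :
    arcLength s Set.univ = ENNReal.ofReal s * ENNReal.ofReal (2 * Real.pi) := by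
  rw [arcLength, Measure.map_apply (continuous_circleMap 0 s).measurable MeasurableSet.univ]
  simp

theorem circleL2Norm_le {s B : ℝ} (hs : 0 ≤ s) (hs1 : s ≤ 1) {f : ℂ → ℂ}
    (hf : ∀ ζ : ℂ, ‖ζ‖ = s → ‖f ζ‖ ≤ B) :
    circleL2Norm s f ≤ ENNReal.ofReal ((2 * Real.pi) ^ (2⁻¹ : ℝ) * B) := by
  refine (eLpNorm_le_of_ae_bound (C := B) ?_).trans ?_
  · filter_upwards [ae_arcLength_mem_sphere hs] with ζ hζ
    exact hf ζ (mem_sphere_zero_iff_norm.1 hζ)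
  · rw [ENNReal.ofReal_mul (by positivity), arcLength_univ,
      ← ENNReal.ofReal_rpow_of_pos (by positivity), ENNReal.toReal_ofNat,
      ← ENNReal.ofReal_mul hs]
    gcongr ENNReal.ofReal ?_ ^ _ * _
    exact mul_le_of_le_one_left (by positivity) hs1

/-- The Cauchy–Schwarz inequality on a circle. -/
theorem integral_norm_circleMap_le {s η : ℝ} (hs : 0 < s) (hη : 0 ≤ η) {f : ℂ → ℂ}
    (hf : ContinuousOn f (Metric.sphere 0 s)) (h : circleL2Norm s f ≤ ENNReal.ofReal η) :
    ∫ θ in (0 : ℝ)..2 * Real.pi, ‖f (circleMap 0 s θ)‖ ≤ η * (2 * Real.pi / s) ^ (2⁻¹ : ℝ) := by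
  have hm : AEStronglyMeasurable f (arcLength s) := by
    rw [← Measure.restrict_eq_self_of_ae_mem (ae_arcLength_mem_sphere hs.le)]
    exact hf.aestronglyMeasurable Metric.isClosed_sphere.measurableSet
  have hc : Continuous (fun θ => f (circleMap 0 s θ)) :=
    hf.comp_continuous (continuous_circleMap 0 s) (circleMap_mem_sphere 0 hs.le)
  have h1 := eLpNorm_le_eLpNorm_mul_rpow_measure_univ (p := 1) (q := 2) (by norm_num) hm
  have hx : ((1 : ℝ≥0∞).toReal)⁻¹ - ((2 : ℝ≥0∞).toReal)⁻¹ = (2⁻¹ : ℝ) := by norm_num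
  rw [arcLength_univ, one_div, one_div, hx, ← ENNReal.ofReal_mul hs.le,
    ENNReal.ofReal_rpow_of_pos (by positivity)] at h1
  have h2 : eLpNorm f 1 (arcLength s) ≤
      ENNReal.ofReal (η * (s * (2 * Real.pi)) ^ (2⁻¹ : ℝ)) := by
    rw [ENNReal.ofReal_mul hη]
    exact h1.trans (mul_le_mul_left h _)
  rw [arcLength, eLpNorm_map_measure hm (continuous_circleMap 0 s).measurable.aemeasurable,
    eLpNorm_smul_measure_of_ne_zero (by simpa using hs), eLpNorm_one_eq_lintegral_enorm] at h2
  rw [intervalIntegral.integral_of_le (by positivity),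
    integral_norm_eq_lintegral_enorm hc.aestronglyMeasurable]
  have h3 := ENNReal.toReal_mono ENNReal.ofReal_ne_top h2
  rw [ENNReal.toReal_ofReal (by positivity)] at h3
  simp only [div_one, ENNReal.toReal_one, ENNReal.rpow_one, smul_eq_mul, ENNReal.toReal_mul,
    ENNReal.toReal_ofReal hs.le, Function.comp_def] at h3
  rw [← le_div_iff₀' hs] at h3
  refine h3.trans_eq ?_
  rw [mul_div_assoc]
  congr 1
  rw [Real.mul_rpow hs.le (by positivity), Real.div_rpow (by positivity) hs.le,
    mul_comm, mul_div_assoc, div_eq_mul_inv]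
  congr 1
  rw [← div_eq_mul_inv, ← Real.rpow_sub_one hs.ne', ← Real.rpow_neg hs.le]
  norm_num

/-! ### Laurent coefficients and the upper bound -/

/-- Up to the factor `2πi`, the `n`-th Laurent coefficient of `f`, computed on `|ζ| = s`. -/
noncomputable def laurentIntegral (f : ℂ → ℂ) (n : ℤ) (s : ℝ) : ℂ :=
  ∮ ζ in C(0, s), (ζ - 0)⁻¹ • (ζ ^ (-n) * f ζ)

theorem laurentIntegral_eq {ρ : ℝ} (hρ : 0 < ρ) {f : ℂ → ℂ} (hf : AnalyticOnNhd ℂ f (annulus ρ))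
    (n : ℤ) {s t : ℝ} (hs : s ∈ Set.Ioo ρ 1) (ht : t ∈ Set.Ioo ρ 1) :
    laurentIntegral f n s = laurentIntegral f n t := by
  wlog hst : t ≤ s generalizing s t
  · exact (this ht hs (le_of_not_ge hst)).symm
  have ht0 : 0 < t := hρ.trans ht.1
  have hd : ∀ ζ : ℂ, t ≤ ‖ζ‖ → ‖ζ‖ ≤ s → DifferentiableAt ℂ (fun ζ => ζ ^ (-n) * f ζ) ζ := by
    intro ζ h1 h2
    exact (differentiableAt_zpow.2 (Or.inl (norm_pos_iff.1 (ht0.trans_le h1)))).mul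
      (hf ζ ⟨ht.1.trans_le h1, h2.trans_lt hs.2⟩).differentiableAt
  refine Complex.circleIntegral_sub_center_inv_smul_eq_of_differentiable_on_annulus_off_countable
    ht0 hst Set.countable_empty (fun ζ hζ => ?_) (fun ζ hζ => ?_)
  · simp only [Set.mem_sdiff, mem_closedBall_zero_iff, mem_ball_zero_iff, not_lt] at hζ
    exact (hd ζ hζ.2 hζ.1).continuousAt.continuousWithinAt
  · simp only [Set.mem_sdiff, mem_closedBall_zero_iff, mem_ball_zero_iff, not_le] at hζ
    exact hd ζ hζ.1.2.le hζ.1.1.le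

theorem norm_laurentIntegral_le (f : ℂ → ℂ) (n : ℤ) {s : ℝ} (hs : 0 < s) :
    ‖laurentIntegral f n s‖ ≤
      s ^ (-n) * ∫ θ in (0 : ℝ)..2 * Real.pi, ‖f (circleMap 0 s θ)‖ := by
  rw [laurentIntegral, circleIntegral, ← intervalIntegral.integral_const_mul]
  refine (intervalIntegral.norm_integral_le_integral_norm (by positivity)).trans_eq ?_
  congr 1
  ext θ
  simp only [norm_smul, norm_mul, norm_zpow, norm_inv, sub_zero, deriv_circleMap,
    norm_circleMap_zero, abs_of_pos hs, Complex.norm_I, mul_one]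
  field_simp

/-- On each circle the values of `f` are bounded by the sum of the moduli of its Laurent
terms. -/
theorem norm_le_tsum_laurentIntegral {f : ℂ → ℂ} {z : ℂ} (hz : z ≠ 0)
    (hf : ContinuousOn f (Metric.sphere 0 ‖z‖))
    (hs : Summable fun n : ℤ => ‖z‖ ^ n * ‖laurentIntegral f n ‖z‖‖) :
    ‖f z‖ ≤ ∑' n : ℤ, ‖z‖ ^ n * ‖laurentIntegral f n ‖z‖‖ := by
  have ha : 0 < ‖z‖ := norm_pos_iff.2 hz
  have : Fact (0 < 2 * Real.pi) := ⟨Real.two_pi_pos⟩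
  have hper : Function.Periodic (fun θ => f (circleMap 0 ‖z‖ θ)) (2 * Real.pi) := fun θ => by
    simp only [periodic_circleMap 0 ‖z‖ θ]
  have hc : Continuous (fun θ => f (circleMap 0 ‖z‖ θ)) :=
    hf.comp_continuous (continuous_circleMap 0 _) (circleMap_mem_sphere 0 ha.le)
  -- As a function of the angle, `f` has Fourier coefficients of modulus `|z|^n` times the Laurent
  -- ones; being summable, they represent `f` pointwise.
  let F : C(AddCircle (2 * Real.pi), ℂ) := ⟨hper.lift, continuous_coinduced_dom.2 hc⟩
  have hF : ∀ θ : ℝ, F θ = f (circleMap 0 ‖z‖ θ) := fun θ => rfl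
  have hcoef : ∀ n : ℤ, ‖fourierCoeff F n‖ =
      (2 * Real.pi)⁻¹ * (‖z‖ ^ n * ‖laurentIntegral f n ‖z‖‖) := by
    intro n
    have hI : laurentIntegral f n ‖z‖ = (Complex.I * (‖z‖ : ℂ) ^ (-n)) *
        ∫ θ in (0 : ℝ)..0 + 2 * Real.pi, fourier (-n) (θ : AddCircle (2 * Real.pi)) • F θ := by
      rw [laurentIntegral, circleIntegral, ← intervalIntegral.integral_const_mul, zero_add]
      congr 1
      ext θ
      have hne : circleMap 0 ‖z‖ θ ≠ 0 := circleMap_ne_center ha.ne'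
      rw [hF, fourier_coe_apply, deriv_circleMap, sub_zero, smul_eq_mul, smul_eq_mul, smul_eq_mul]
      have : (circleMap 0 ‖z‖ θ) ^ (-n) = (‖z‖ : ℂ) ^ (-n) *
          Complex.exp (2 * Real.pi * Complex.I * ((-n : ℤ) : ℂ) * θ / ((2 * Real.pi : ℝ) : ℂ)) := by
        rw [circleMap, zero_add, mul_zpow, ← Complex.exp_int_mul]
        congr 2
        have : (Real.pi : ℂ) ≠ 0 := by exact_mod_cast Real.pi_ne_zero
        push_cast
        field_simp
      rw [this]
      field_simp
    rw [hI, fourierCoeff_eq_intervalIntegral F n 0, norm_smul, norm_mul, norm_mul, norm_zpow,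
      Complex.norm_I, Complex.norm_real, norm_norm, zpow_neg, one_mul, ← mul_assoc (‖z‖ ^ n),
      mul_inv_cancel₀ (zpow_pos ha n).ne', one_mul, one_div, norm_inv, Real.norm_of_nonneg
      Real.two_pi_pos.le]
  have hs' : Summable (fun n => ‖fourierCoeff F n‖) := by
    simp only [hcoef]
    exact hs.mul_left _
  have hsum := has_pointwise_sum_fourier_series_of_summable hs'.of_norm
    ((Complex.arg z : ℝ) : AddCircle (2 * Real.pi))
  have hval : F ((Complex.arg z : ℝ) : AddCircle (2 * Real.pi)) = f z := by
    rw [hF]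
    congr 1
    simp [circleMap]
  rw [hval] at hsum
  have hn : ∀ n, ‖fourierCoeff F n • fourier n ((Complex.arg z : ℝ) : AddCircle (2 * Real.pi))‖ =
      ‖fourierCoeff F n‖ := by
    intro n
    rw [norm_smul, fourier_apply, Circle.norm_coe, mul_one]
  rw [← hsum.tsum_eq]
  refine (norm_tsum_le_tsum_norm (by simpa only [hn] using hs')).trans ?_
  simp only [hn]
  refine hs'.tsum_le_tsum (fun n => ?_) hs
  rw [hcoef]
  refine mul_le_of_le_one_left (by positivity) (inv_le_one_of_one_le₀ ?_)
  linarith [Real.pi_gt_three]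

/-- A function on an open interval that is continuous up to the endpoints and at least `x` inside
is at least `x` at the endpoints. -/
theorem le_of_forall_mem_Ioo_le {a b x : ℝ} (hab : a < b) {φ : ℝ → ℝ}
    (hφ : ContinuousOn φ (Set.Icc a b)) (h : ∀ s ∈ Set.Ioo a b, x ≤ φ s) :
    ∀ s ∈ Set.Icc a b, x ≤ φ s := by
  rw [← closure_Ioo hab.ne] at hφ ⊢
  exact fun s hs => le_on_closure h continuousOn_const hφ hs

/-- Converts a minimum into a kernel: `min(1, A/B) ≤ 2A/(A + B)`. -/
theorem le_two_mul_div {x A B : ℝ} (hA : 0 < A) (hB : 0 < B) {K : ℝ} (h1 : x ≤ K) (h2 : x ≤ K * (A / B)) : x ≤ 2 * K * A / (B + A) := by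
  rw [mul_div_assoc', le_div_iff₀ hB] at h2
  rw [le_div_iff₀ (by positivity)]
  nlinarith

/-- The upper bound for `|f(z)|`. -/
theorem norm_le_mul_rpow_gammaExp {ρ r : ℝ} (hρ : 0 < ρ) (hρr : ρ < r) (hr : r < 1) {z : ℂ}
    (hz : z ∈ annulus ρ \ circ r) :
    ∃ C : ℝ, 0 < C ∧ ∀ ε : ℝ, 0 < ε → ∀ f ∈ hardySpace ρ,
      hardyNorm ρ f ≤ 1 → circleL2Norm r f ≤ ENNReal.ofReal ε →
        ‖f z‖ ≤ C * ε ^ gammaExp ρ r z := by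
  obtain ⟨g0, g1, h1, h2, -⟩ := gammaExp_spec hρ hρr hr hz
  have hr0 : 0 < r := hρ.trans hρr
  have hq : 0 < ρ / r := by positivity
  have ha : 0 < ‖z‖ := hρ.trans hz.1.1
  obtain ⟨C, hC, hsum⟩ := tsum_le_of_le_kernels hr0 hr hq ((div_lt_one hr0).2 hρr) g0 g1
  set K : ℝ := (2 * Real.pi / ρ) ^ (2⁻¹ : ℝ)
  have hK : 0 < K := by positivity
  refine ⟨2 * K * C, by positivity, fun ε hε f hf hf1 hfr => ?_⟩
  have hcont : ∀ s ∈ Set.Ioo ρ 1, ContinuousOn f (Metric.sphere 0 s) := fun s hs =>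
    hf.1.continuousOn.mono fun ζ hζ => by
      rw [mem_sphere_zero_iff_norm] at hζ
      exact ⟨hζ ▸ hs.1, hζ ▸ hs.2⟩
  set L : ℤ → ℂ := fun n => laurentIntegral f n ‖z‖
  have hL : ∀ (n : ℤ) (s η : ℝ), s ∈ Set.Ioo ρ 1 → 0 ≤ η →
      circleL2Norm s f ≤ ENNReal.ofReal η → ‖L n‖ ≤ η * K * s ^ (-n) := by
    intro n s η hs hη h
    have hs0 : 0 < s := hρ.trans hs.1
    simp only [L]
    rw [laurentIntegral_eq hρ hf.1 n hz.1 hs, mul_comm]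
    refine (norm_laurentIntegral_le f n hs0).trans ?_
    gcongr
    refine (integral_norm_circleMap_le hs0 hη (hcont s hs) h).trans ?_
    simp only [K]
    have := hs.1.le
    gcongr
  -- The coefficient does not depend on `s`, so the bound passes to `s = ρ` and `s = 1` by
  -- continuity of `s^(-n)`; no boundary values of `f` are needed.
  have hL1 : ∀ (n : ℤ), ∀ s ∈ Set.Icc ρ 1, ‖L n‖ ≤ K * s ^ (-n) := by
    intro n
    refine le_of_forall_mem_Ioo_le (hρr.trans hr) (fun s hs => ?_) (fun s hs => ?_)
    · exact ((continuousAt_zpow₀ s (-n) (Or.inl (hρ.trans_le hs.1).ne')).const_mul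
        K).continuousWithinAt
    · simpa using hL n s 1 hs zero_le_one
        (by simpa using (le_iSup₂ (f := fun s _ => circleL2Norm s f) s hs).trans hf1)
  have hLr : ∀ n : ℤ, ‖L n‖ ≤ ε * K * r ^ (-n) := fun n => hL n r ε ⟨hρr, hr⟩ hε.le hfr
  have key := hsum ε hε (fun n => (‖z‖ ^ n * ‖L n‖) / (2 * K * ε)) (fun n => by positivity)
    (fun n => ?_) (fun n => ?_)
  · obtain ⟨s, t⟩ := key
    rw [tsum_div_const, div_le_iff₀ (by positivity)] at t
    have s' : Summable fun n => ‖z‖ ^ n * ‖L n‖ := by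
      refine (s.mul_right (2 * K * ε)).congr fun n => ?_
      field_simp
    refine (norm_le_tsum_laurentIntegral (norm_pos_iff.1 ha) (hcont _ hz.1) s').trans
      (t.trans_eq ?_)
    rw [Real.rpow_sub_one hε.ne']
    field_simp
  · have e1 : ‖L n‖ ≤ K := by simpa using hL1 n 1 ⟨(hρr.trans hr).le, le_rfl⟩
    have e2 : ‖L n‖ ≤ K * (ε / r ^ n) := by
      refine (hLr n).trans_eq ?_
      rw [zpow_neg, zpow_natCast]
      ring
    have e3 := le_two_mul_div hε (pow_pos hr0 n) e1 e2
    rw [Real.rpow_one, Real.rpow_one, zpow_natCast, ← Real.rpow_pow_comm hr0.le]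
    calc ‖z‖ ^ n * ‖L n‖ / (2 * K * ε)
        ≤ (r ^ gammaExp ρ r z) ^ n * (2 * K * ε / (r ^ n + ε)) / (2 * K * ε) := by gcongr
      _ = _ := by field_simp
  · have e1 : ‖L (-n)‖ ≤ K * ρ ^ n := by
      simpa using hL1 (-n) ρ ⟨le_rfl, (hρr.trans hr).le⟩
    have e2 : ‖L (-n)‖ ≤ K * ρ ^ n * (ε / (ρ / r) ^ n) := by
      refine (hLr (-n)).trans_eq ?_
      rw [neg_neg, zpow_natCast, div_pow]
      field_simp
    have e3 := le_two_mul_div hε (pow_pos hq n) e1 e2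
    rw [Real.rpow_one, Real.rpow_one, zpow_neg, zpow_natCast, ← Real.rpow_pow_comm hq.le]
    calc (‖z‖ ^ n)⁻¹ * ‖L (-n)‖ / (2 * K * ε)
        ≤ (‖z‖ ^ n)⁻¹ * (2 * (K * ρ ^ n) * ε / ((ρ / r) ^ n + ε)) / (2 * K * ε) := by gcongr
      _ = (ρ / ‖z‖) ^ n / ((ρ / r) ^ n + ε) := by
          rw [div_pow ρ ‖z‖]
          field_simp
      _ ≤ _ := by gcongr

end AnnulusContinuation

/-! ### Assembly -/

theorem mainTheorem1 (ρ r : ℝ) (hρ : 0 < ρ) (hρr : ρ < r) (hr : r < 1)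
    (z : ℂ) (hz : z ∈ annulus ρ \ circ r) :
    -- the upper bound
    (∃ C : ℝ, 0 < C ∧ ∀ ε : ℝ, 0 < ε → ∀ f ∈ hardySpace ρ,
      hardyNorm ρ f ≤ 1 → circleL2Norm r f ≤ ENNReal.ofReal ε →
        ‖f z‖ ≤ C * ε ^ gammaExp ρ r z) ∧
    -- the series converges on the closed annulus, and its sum is analytic there
    (∀ ε : ℝ, 0 < ε →
      (∀ ζ ∈ closure (annulus ρ), Summable (maxTerm ρ r ε z ζ)) ∧
      AnalyticOnNhd ℂ (maxFun ρ r ε z) (closure (annulus ρ))) ∧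
    -- the bound is attained by `M`, with constants independent of `ε`
    (∃ C c : ℝ, 0 < C ∧ 0 < c ∧ ∀ ε : ℝ, 0 < ε →
      maxFun ρ r ε z ∈ hardySpace ρ ∧
      hardyNorm ρ (maxFun ρ r ε z) ≤ ENNReal.ofReal C ∧
      circleL2Norm r (maxFun ρ r ε z) ≤ ENNReal.ofReal (C * ε) ∧
      ‖maxFun ρ r ε z z‖ ≤ C * ε ^ gammaExp ρ r z ∧
      (ε ≤ 1 → c * ε ^ gammaExp ρ r z ≤ ‖maxFun ρ r ε z z‖)) ∧
    -- `M` is bounded on the closed annulus, uniformly in `ε`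
    (∃ C : ℝ, 0 < C ∧ ∀ ε : ℝ, 0 < ε → ∀ ζ ∈ closure (annulus ρ),
      ‖maxFun ρ r ε z ζ‖ ≤ C) := by
  have hr0 : 0 < r := hρ.trans hρr
  obtain ⟨g0, g1, h1, h2, -⟩ := gammaExp_spec hρ hρr hr hz
  obtain ⟨C₀, hC₀, H₀⟩ := norm_maxFun_le hρ hρr hr hz (δ := 0) le_rfl zero_le_one
  obtain ⟨C₁, hC₁, H₁⟩ := norm_maxFun_le hρ hρr hr hz (δ := 1) zero_le_one le_rfl
  obtain ⟨C₂, hC₂, H₂⟩ := norm_maxFun_le hρ hρr hr hz g0.le g1.le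
  obtain ⟨c, hc, Hc⟩ := le_norm_maxFun hρ hρr hr hz
  have hcl := closure_annulus_subset ρ
  have hbd : ∀ ε : ℝ, 0 < ε → ∀ ζ : ℂ, ρ ≤ ‖ζ‖ → ‖ζ‖ ≤ 1 →
      Summable (maxTerm ρ r ε z ζ) ∧ ‖maxFun ρ r ε z ζ‖ ≤ C₀ := by
    intro ε hε ζ k1 k2
    simpa using H₀ ε hε ζ (by simpa using k2)
      (by simpa using (div_le_one (hρ.trans_le k1)).2 k1)
  have han : ∀ ε : ℝ, 0 < ε → AnalyticOnNhd ℂ (maxFun ρ r ε z) (closure (annulus ρ)) :=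
    fun ε hε => (analyticOnNhd_maxFun hρ hr0 hz.1 hε).mono hcl
  set P : ℝ := (2 * Real.pi) ^ (2⁻¹ : ℝ)
  have hP : 0 < P := by positivity
  have hH : ∀ ε : ℝ, 0 < ε → hardyNorm ρ (maxFun ρ r ε z) ≤ ENNReal.ofReal (P * C₀) :=
    fun ε hε => iSup₂_le fun s hs => circleL2Norm_le (hρ.trans hs.1).le hs.2.le
      fun ζ hζ => (hbd ε hε ζ (hζ ▸ hs.1.le) (hζ ▸ hs.2.le)).2
  refine ⟨norm_le_mul_rpow_gammaExp hρ hρr hr hz,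
    fun ε hε => ⟨fun ζ hζ => (hbd ε hε ζ (hcl hζ).1 (hcl hζ).2).1, han ε hε⟩,
    ⟨P * C₀ + P * C₁ + C₂, c, by positivity, hc, fun ε hε => ⟨⟨(han ε hε).mono subset_closure,
      (hH ε hε).trans_lt ENNReal.ofReal_lt_top⟩, (hH ε hε).trans ?_, ?_, ?_, Hc ε hε⟩⟩,
    ⟨C₀, hC₀, fun ε hε ζ hζ => (hbd ε hε ζ (hcl hζ).1 (hcl hζ).2).2⟩⟩
  · apply ENNReal.ofReal_le_ofReal
    nlinarith [mul_pos hP hC₁]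
  · refine (circleL2Norm_le (B := C₁ * ε) hr0.le hr.le fun ζ hζ => ?_).trans ?_
    · simpa using (H₁ ε hε ζ (by simp [hζ]) (by simp [hζ])).2
    · apply ENNReal.ofReal_le_ofReal
      rw [← mul_assoc]
      gcongr
      change P * C₁ ≤ _
      nlinarith [mul_pos hP hC₀]
  · refine (H₂ ε hε z h1 h2).2.trans ?_
    gcongr
    nlinarith [mul_pos hP hC₁, mul_pos hP hC₀]
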